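/- Let $q\ge 2$ be an integer, let $\phi$ be Euler's totient function, $B_k$ the $k$-th Bernoulli number, and for $l\ge 1$ let $J_l(q)=q^l\prod_{p\mid q,\ p\text{ prime}}\bigl(1-p^{-l}\bigr)$ be Jordan's totient function. For positive integers $m_1,m_2,m_3$ and integers $a,b,c$ put $$V_{\chi_1,\chi_2,q}(m_1,m_2,m_3;a,b,c)=\sum_{\substack{\chi_1,\chi_2\ (\mathrm{mod}\ q)\\ \chi_1(-1)=(-1)^{m_1}\\ \chi_2(-1)=(-1)^{m_2}}}\chi_1(a)\chi_2(b)\overline{\chi_1\chi_2}(c)\,L(m_1,\chi_1)L(m_2,\chi_2)L(m_3,\overline{\chi_1\chi_2}),$$ where $\chi_1,\chi_2$ run over the Dirichlet characters modulo $q$, and $L(s,\chi)$ is the Dirichlet $L$-function, $L(s,\chi)=\sum_{k\ge1}\chi(k)k^{-s}$ for $\Re(s)>1$, continued analytically. Then for every even positive integer $n$, $$V_{\chi_1,\chi_2,q}(1,1,n;1,1,1)=\frac{(-1)^{n/2}(2\pi)^{n+2}\phi(q)^2}{8q^{n+2}\,n!}\,(M_1+M_2+M_3),$$ where $$M_1=2\sum_{j=1}^{n/2}\binom{n}{2j}\frac{B_{2j}B_{n+2-2j}J_{2j}(q)}{(n+2-2j)(n+1-2j)},$$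 $$M_2=\sum_{j=3}^{n-1}\binom{n}{j}\frac{B_{n+1-j}}{n+1-j}\sum_{l=2}^{j-1}\binom{j}{l}\frac{B_lB_{j+1-l}J_l(q)}{j+1-l},$$ $$M_3=-\frac{B_2B_nJ_2(q)}{2}+\frac{B_{n+2}J_{n+2}(q)}{(n+2)(n+1)},$$ and $M_2=0$ when $n=2$. In particular (the case $n=2$ being Alkan's formula), $$V_{\chi_1,\chi_2,q}(1,1,2;1,1,1)=\frac{\pi^4\phi(q)^2}{360q^4}\bigl(J_4(q)-5J_2(q)\bigr),$$ $$V_{\chi_1,\chi_2,q}(1,1,4;1,1,1)=\frac{\pi^6\phi(q)^2}{3780q^6}\bigl(J_6(q)-7J_4(q)+14J_2(q)\bigr).$$ -/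

import Mathlib

open scoped ComplexConjugate

noncomputable section

/-- Jordan's totient function `J_l(q) = q ^ l * ∏_{p ∣ q, p prime} (1 - 1 / p ^ l)`. -/
def jordanTotient (l q : ℕ) : ℚ :=
  (q : ℚ) ^ l * ∏ p ∈ q.primeFactors, (1 - 1 / (p : ℚ) ^ l)

/-- The Dirichlet characters `χ` modulo `q` with `χ(-1) = (-1) ^ m`. -/
def charsOfParity (q m : ℕ) [NeZero q] : Set (DirichletCharacter ℂ q) :=
  {χ | χ (-1) = (-1) ^ m}

open Classical in
/-- The mean value `V_{χ₁,χ₂,q}(m₁, m₂, m₃; a, b, c)`: the sum, over all pairs of Dirichlet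
characters `χ₁, χ₂` modulo `q` with `χ₁(-1) = (-1) ^ m₁` and `χ₂(-1) = (-1) ^ m₂`, of
`χ₁(a) χ₂(b) conj((χ₁χ₂)(c)) L(m₁, χ₁) L(m₂, χ₂) L(m₃, conj(χ₁χ₂))`.
The conjugate character is `star (χ₁ * χ₂)`, the pointwise complex conjugate; `L(s, χ)` is the
Dirichlet `L`-function, continued analytically from `Re s > 1`. -/
def meanV (q : ℕ) [NeZero q] (m₁ m₂ m₃ : ℕ) (a b c : ℤ) : ℂ :=
  ∑ χ₁ : DirichletCharacter ℂ q with χ₁ ∈ charsOfParity q m₁,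
    ∑ χ₂ : DirichletCharacter ℂ q with χ₂ ∈ charsOfParity q m₂,
      χ₁ (a : ZMod q) * χ₂ (b : ZMod q) * conj ((χ₁ * χ₂) (c : ZMod q)) *
        DirichletCharacter.LFunction χ₁ m₁ * DirichletCharacter.LFunction χ₂ m₂ *
        DirichletCharacter.LFunction (star (χ₁ * χ₂)) m₃

/-- The term `M₁`. -/
def termM₁ (q n : ℕ) : ℚ :=
  2 * ∑ j ∈ Finset.Icc 1 (n / 2),
    (n.choose (2 * j) : ℚ) *
      (bernoulli (2 * j) * bernoulli (n + 2 - 2 * j) * jordanTotient (2 * j) q /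
        (((n : ℚ) + 2 - 2 * j) * ((n : ℚ) + 1 - 2 * j)))

/-- The term `M₂`. -/
def termM₂ (q n : ℕ) : ℚ :=
  ∑ j ∈ Finset.Icc 3 (n - 1),
    (n.choose j : ℚ) * (bernoulli (n + 1 - j) / ((n : ℚ) + 1 - j)) *
      ∑ l ∈ Finset.Icc 2 (j - 1),
        (j.choose l : ℚ) *
          (bernoulli l * bernoulli (j + 1 - l) * jordanTotient l q / ((j : ℚ) + 1 - l))

/-- The term `M₃`. -/
def termM₃ (q n : ℕ) : ℚ :=
  -(bernoulli 2 * bernoulli n * jordanTotient 2 q / 2) +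
    bernoulli (n + 2) * jordanTotient (n + 2) q / (((n : ℚ) + 2) * ((n : ℚ) + 1))

end

open Filter Topology

/-! Write `E_k(x) = ∑ (x + j)⁻ᵏ` over `j ∈ ℤ`. The L-values are finite sums of Hurwitz zeta values
at `j / q`, and orthogonality of characters collapses the double character sum to a sum over units
`j` of (odd zeta at 1)² times (even zeta at `n`). At `a = j / q` these values are `π cot(πa) / 2`
and `E_n(a) / 2`.

Differentiating the cotangent series gives `(π cot πa)² = E_2(a) - π²`, and `eisensteinSum_two_mul`
expands `E_2 E_n` linearly in the `E_k` with zeta coefficients. So each summand is a linear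
combination of even Hurwitz values, whose sums over units are `ζ(m) J_m(q)`.

Euler's formula for `ζ(2k)` turns the result into Bernoulli numbers. The inner convolution of `M₂`
is evaluated by Euler's quadratic recurrence, after which `termM_sum_eq` matches both sides term by
term. -/

/-- The partial fraction decomposition of `y⁻² z⁻ⁿ` where `z = y + m`. -/
lemma inv_sq_mul_inv_pow_partial_fractions {y z m : ℂ} (hy : y ≠ 0) (hz : z ≠ 0) (hm : m ≠ 0)
    (h : z = y + m) (n : ℕ) :
    (y ^ 2)⁻¹ * (z ^ n)⁻¹ = (m ^ n)⁻¹ * (y ^ 2)⁻¹ - n * (m ^ (n + 1))⁻¹ * y⁻¹ +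
      ∑ k ∈ Finset.range n, (k + 1) * (m ^ (k + 2))⁻¹ * (z ^ (n - k))⁻¹ := by
  induction n with
  | zero => simp
  | succ n ih =>
    have h1 : ∑ k ∈ Finset.range n, ((k : ℂ) + 1) * (m ^ (k + 2))⁻¹ * (z ^ (n + 1 - k))⁻¹ =
        (∑ k ∈ Finset.range n, ((k : ℂ) + 1) * (m ^ (k + 2))⁻¹ * (z ^ (n - k))⁻¹) * z⁻¹ := by
      rw [Finset.sum_mul]
      refine Finset.sum_congr rfl fun k hk ↦ ?_
      rw [Nat.sub_add_comm (Finset.mem_range.mp hk).le, pow_succ z, mul_inv, mul_assoc, mul_assoc, mul_assoc]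
    rw [Finset.sum_range_succ, h1, pow_succ z n, mul_inv, ← mul_assoc, ih]
    -- This identity and `h3`, its multiple by `y⁻¹` reduced once more, re-expand what the extra
    -- factor `z⁻¹` produces.
    have h2 : y⁻¹ * z⁻¹ = m⁻¹ * (y⁻¹ - z⁻¹) := by
      rw [inv_sub_inv hy hz, h, add_sub_cancel_left]
      rw [h] at hz
      field_simp
    have h3 : (y ^ 2)⁻¹ * z⁻¹ = m⁻¹ * (y ^ 2)⁻¹ - (m ^ 2)⁻¹ * (y⁻¹ - z⁻¹) := by
      linear_combination (y⁻¹ - m⁻¹) * h2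
    have h4 : n + 1 - n = 1 := by lia
    rw [add_mul, sub_mul, mul_assoc, h3, mul_assoc _ (y⁻¹), h2, h4]
    push_cast
    ring

/-! ### Telescoping and products of series over the integers. -/

section IntegerSums

variable {f g c : ℤ → ℂ} {a b : ℂ}

lemma HasSum.int_add_right (h : HasSum f a) (m : ℤ) : HasSum (fun j ↦ f (j + m)) a :=
  (Equiv.addRight m).hasSum_iff.mpr h

lemma Summable.int_natCast (h : Summable f) : Summable fun n : ℕ ↦ f n :=
  h.comp_injective (i := fun n : ℕ ↦ (n : ℤ)) Nat.cast_injective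

lemma Summable.int_neg_natCast_add_one (h : Summable f) :
    Summable fun n : ℕ ↦ f (-((n : ℤ) + 1)) :=
  h.comp_injective (i := fun n : ℕ ↦ -((n : ℤ) + 1)) fun a b h ↦ by
    exact_mod_cast add_right_cancel (neg_injective h)

/-- Both half-lines telescope, contributing `-f 0` and `f 0`. -/
lemma hasSum_int_succ_sub (hs : Summable fun j ↦ f (j + 1) - f j)
    (h₁ : Tendsto (fun n : ℕ ↦ f n) atTop (𝓝 0)) (h₂ : Tendsto (fun n : ℕ ↦ f (-n)) atTop (𝓝 0)) :
    HasSum (fun j ↦ f (j + 1) - f j) 0 := by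
  have h3 : HasSum (fun n : ℕ ↦ f (n + 1) - f n) (0 - f 0) := by
    refine (hs.int_natCast.hasSum_iff_tendsto_nat).mpr ?_
    have (n : ℕ) := Finset.sum_range_sub (fun n : ℕ ↦ f n) n
    simp only [Nat.cast_add, Nat.cast_one, Nat.cast_zero] at this
    simp only [this]
    exact h₁.sub_const _
  have h4 : HasSum (fun n : ℕ ↦ f (-((n : ℤ) + 1) + 1) - f (-((n : ℤ) + 1))) (f 0 - 0) := by
    refine (hs.int_neg_natCast_add_one.hasSum_iff_tendsto_nat).mpr ?_
    have (n : ℕ) := Finset.sum_range_sub' (fun n : ℕ ↦ f (-n)) n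
    simp only [Nat.cast_add, Nat.cast_one, Nat.cast_zero, neg_zero] at this
    have e (n : ℕ) : -((n : ℤ) + 1) + 1 = -n := by ring
    simp only [e, this]
    exact h₂.const_sub _
  simpa using HasSum.of_nat_of_neg_add_one (f := fun j ↦ f (j + 1) - f j) h3 h4

lemma hasSum_int_add_sub (hs : Summable fun j ↦ f (j + 1) - f j)
    (h₁ : Tendsto (fun n : ℕ ↦ f n) atTop (𝓝 0)) (h₂ : Tendsto (fun n : ℕ ↦ f (-n)) atTop (𝓝 0))
    (m : ℤ) : HasSum (fun j ↦ f (j + m) - f j) 0 := by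
  have step (m : ℤ) : HasSum (fun j ↦ f (j + m + 1) - f (j + m)) 0 :=
    (hasSum_int_succ_sub hs h₁ h₂).int_add_right m
  induction m with
  | zero => simp
  | succ m ih =>
    have := (step m).add ih
    simpa only [sub_add_sub_cancel, add_zero, add_assoc] using this
  | pred m ih =>
    have := ih.sub (step (-m - 1))
    simp only [sub_zero] at this
    refine this.congr_fun fun j ↦ ?_
    rw [show j + (-(m : ℤ) - 1) + 1 = j + -m by ring]
    ring

/-- Absolute convergence lets the double series be summed along the diagonals of constant index
difference `m`. -/
lemma HasSum.mul_int_of_diagonals (hf : HasSum f a) (hg : HasSum g b)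
    (h : ∀ m, HasSum (fun j ↦ f j * g (j + m)) (c m)) : HasSum c (a * b) := by
  have h' := hf.mul hg (summable_mul_of_summable_norm hf.summable.norm hg.summable.norm)
  let e : ℤ × ℤ ≃ ℤ × ℤ :=
    { toFun p := (p.2, p.2 + p.1)
      invFun p := (p.2 - p.1, p.1)
      left_inv p := by simp
      right_inv p := by simp }
  rw [← e.hasSum_iff] at h'
  exact h'.prod_fiberwise h

end IntegerSums

/-! ### Eisenstein series and the cotangent. -/

section EisensteinSums

variable {x : ℂ}

lemma summable_inv_add_intCast_pow (x : ℂ) {k : ℕ} (hk : 2 ≤ k) :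
    Summable fun j : ℤ ↦ ((x + j) ^ k)⁻¹ := by
  simpa using EisensteinSeries.linear_right_summable x 1 (k := k) (by lia)

/-- The Eisenstein series `∑ (x + j)⁻ᵏ` over the integers. -/
noncomputable def eisensteinSum (k : ℕ) (x : ℂ) : ℂ := ∑' j : ℤ, ((x + j) ^ k)⁻¹

lemma hasSum_eisensteinSum (x : ℂ) {k : ℕ} (hk : 2 ≤ k) :
    HasSum (fun j : ℤ ↦ ((x + j) ^ k)⁻¹) (eisensteinSum k x) :=
  (summable_inv_add_intCast_pow x hk).hasSum

/-- The weight-one series is not absolutely convergent, but unit-step differences decay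
quadratically and telescope. This removes the simple poles from the partial fractions. -/
lemma hasSum_inv_add_int_add_sub (hx : x ∈ Complex.integerComplement) (m : ℤ) :
    HasSum (fun j : ℤ ↦ (x + (j + m : ℤ))⁻¹ - (x + j)⁻¹) 0 := by
  have hne (j : ℤ) : x + j ≠ 0 := Complex.integerComplement_add_ne_zero hx j
  have hz := EisensteinSeries.tendsto_zero_inv_linear x 1
  have hz' := EisensteinSeries.tendsto_zero_inv_linear_sub x 1
  simp only [Int.cast_one, one_mul, one_div] at hz hz'
  refine hasSum_int_add_sub (f := fun j : ℤ ↦ (x + j)⁻¹) ?_ (by simpa using hz)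
    (by simpa [← sub_eq_add_neg] using hz') m
  refine (EisensteinSeries.summable_linear_right_add_one_mul_linear_right x 1 1).neg.congr
    fun j ↦ ?_
  rw [inv_sub_inv (hne _) (hne _)]
  push_cast
  rw [← add_assoc, div_eq_mul_inv, one_mul]
  ring

lemma hasSum_inv_sq_mul_inv_pow_shift (hx : x ∈ Complex.integerComplement) {n : ℕ} (hn : 2 ≤ n)
    {m : ℤ} (hm : m ≠ 0) :
    HasSum (fun j : ℤ ↦ ((x + j) ^ 2)⁻¹ * ((x + (j + m : ℤ)) ^ n)⁻¹)
      (((m : ℂ) ^ n)⁻¹ * eisensteinSum 2 x + ∑ k ∈ Finset.range (n - 1),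
        (k + 1) * ((m : ℂ) ^ (k + 2))⁻¹ * eisensteinSum (n - k) x) := by
  have hne (j : ℤ) : x + j ≠ 0 := Complex.integerComplement_add_ne_zero hx j
  have h1 := (hasSum_eisensteinSum x le_rfl).mul_left ((m : ℂ) ^ n)⁻¹
  have h2 := (hasSum_inv_add_int_add_sub hx m).mul_left (n * ((m : ℂ) ^ (n + 1))⁻¹)
  have h3 : HasSum (fun j : ℤ ↦ ∑ k ∈ Finset.range (n - 1),
      ((k : ℂ) + 1) * ((m : ℂ) ^ (k + 2))⁻¹ * ((x + (j + m : ℤ)) ^ (n - k))⁻¹)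
      (∑ k ∈ Finset.range (n - 1),
        (k + 1) * ((m : ℂ) ^ (k + 2))⁻¹ * eisensteinSum (n - k) x) := by
    refine hasSum_sum fun k hk ↦ ?_
    have : 2 ≤ n - k := by have := Finset.mem_range.mp hk; lia
    exact ((hasSum_eisensteinSum x this).int_add_right m).mul_left _
  have h := (h1.add h2).add h3
  rw [mul_zero, add_zero] at h
  refine h.congr_fun fun j ↦ ?_
  rw [inv_sq_mul_inv_pow_partial_fractions (hne j) (hne (j + m)) (Int.cast_ne_zero.mpr hm)
    (by push_cast; ring) n]
  obtain ⟨l, rfl⟩ : ∃ l, n = l + 1 := ⟨n - 1, by lia⟩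
  -- The split-off term `k = n - 1` is the simple pole in `z`; its coefficient is opposite to that
  -- of `y⁻¹`, so the two form the telescoping difference `h2`.
  rw [Finset.sum_range_succ]
  simp only [Nat.add_sub_cancel, Nat.add_sub_cancel_left, pow_one]
  push_cast
  ring

/-- The product of two Eisenstein series, one of them of weight `2`. -/
theorem eisensteinSum_two_mul (hx : x ∈ Complex.integerComplement) {n : ℕ} (hn : 2 ≤ n) :
    eisensteinSum 2 x * eisensteinSum n x = eisensteinSum (n + 2) x +
      (eisensteinSum n 0 * eisensteinSum 2 x + ∑ k ∈ Finset.range (n - 1),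
        (k + 1) * eisensteinSum (k + 2) 0 * eisensteinSum (n - k) x) := by
  -- Only the diagonal `m = 0` gives weight `n + 2`. Since `0⁻¹ = 0`, the other terms vanish there,
  -- and summing them over all `m` yields `eisensteinSum _ 0`, a sum over nonzero integers.
  have hfib (m : ℤ) : HasSum (fun j : ℤ ↦ ((x + j) ^ 2)⁻¹ * ((x + (j + m : ℤ)) ^ n)⁻¹)
      ((if m = 0 then eisensteinSum (n + 2) x else 0) +
      (((0 + m : ℂ) ^ n)⁻¹ * eisensteinSum 2 x + ∑ k ∈ Finset.range (n - 1),
        (k + 1) * ((0 + m : ℂ) ^ (k + 2))⁻¹ * eisensteinSum (n - k) x)) := by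
    simp only [zero_add]
    split_ifs with hm
    · have : n ≠ 0 := by lia
      simp only [hm, add_zero, Int.cast_zero, ne_eq, this, not_false_eq_true, zero_pow, inv_zero,
        zero_mul, Nat.add_eq_zero_iff, OfNat.ofNat_ne_zero, and_false, mul_zero,
        Finset.sum_const_zero]
      refine (hasSum_eisensteinSum x (show 2 ≤ n + 2 by lia)).congr_fun fun j ↦ ?_
      rw [← mul_inv, ← pow_add, add_comm n]
    · rw [zero_add]
      exact hasSum_inv_sq_mul_inv_pow_shift hx hn hm
  refine ((hasSum_eisensteinSum x le_rfl).mul_int_of_diagonals (hasSum_eisensteinSum x hn)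
    hfib).unique (.add ?_ (.add ?_ ?_))
  · exact hasSum_ite_eq 0 _
  · exact (hasSum_eisensteinSum 0 hn).mul_right _
  · exact hasSum_sum fun k _ ↦
      ((hasSum_eisensteinSum 0 (show 2 ≤ k + 2 by lia)).mul_left _).mul_right _

lemma eisensteinSum_zero_of_even {k : ℕ} (hk : 2 ≤ k) (hk2 : Even k) :
    eisensteinSum k 0 = 2 * riemannZeta k := by
  simp [eisensteinSum, two_mul_riemannZeta_eq_tsum_int_inv_pow_of_even hk hk2]

lemma eisensteinSum_zero_of_odd {k : ℕ} (hk : Odd k) : eisensteinSum k 0 = 0 := by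
  have : eisensteinSum k 0 = -eisensteinSum k 0 := by
    rw [eisensteinSum, ← tsum_neg, ← (Equiv.neg ℤ).tsum_eq]
    simp [hk.neg_pow, inv_neg]
  exact self_eq_neg.mp this

/-- The product formula for Eisenstein series with the coefficients as zeta values. -/
theorem eisensteinSum_two_mul_even (hx : x ∈ Complex.integerComplement) {r : ℕ} (hr : 1 ≤ r) :
    eisensteinSum 2 x * eisensteinSum (2 * r) x = eisensteinSum (2 * r + 2) x +
      (2 * riemannZeta (2 * r : ℕ) * eisensteinSum 2 x + ∑ i ∈ Finset.range r,
        (2 * i + 1) * (2 * riemannZeta (2 * i + 2 : ℕ)) * eisensteinSum (2 * r - 2 * i) x) := by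
  rw [eisensteinSum_two_mul hx (by lia), eisensteinSum_zero_of_even (by lia) (even_two_mul r)]
  congr 2
  -- Odd `k` drop out because their coefficients vanish. The length is decoupled from `r` so that
  -- induction applies.
  have : ∀ s : ℕ, ∑ k ∈ Finset.range (2 * s + 1),
      ((k : ℂ) + 1) * eisensteinSum (k + 2) 0 * eisensteinSum (2 * r - k) x =
      ∑ i ∈ Finset.range (s + 1), (2 * i + 1) * (2 * riemannZeta (2 * i + 2 : ℕ)) *
        eisensteinSum (2 * r - 2 * i) x := by
    intro s
    induction s with
    | zero => simp [eisensteinSum_zero_of_even le_rfl even_two]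
    | succ s ih =>
      rw [Finset.sum_range_succ _ (s + 1), ← ih, show 2 * (s + 1) + 1 = 2 * s + 1 + 1 + 1 by ring,
        Finset.sum_range_succ, Finset.sum_range_succ,
        eisensteinSum_zero_of_odd (k := 2 * s + 1 + 2) ⟨s + 1, by ring⟩,
        eisensteinSum_zero_of_even (k := 2 * s + 1 + 1 + 2) (by lia) ⟨s + 2, by ring⟩]
      simp only [mul_zero, zero_mul, add_zero]
      rw [show 2 * s + 1 + 1 + 2 = 2 * (s + 1) + 2 by ring, show 2 * s + 1 + 1 = 2 * (s + 1) by ring]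
      push_cast
      ring
  obtain ⟨s, rfl⟩ : ∃ s, r = s + 1 := ⟨r - 1, by lia⟩
  exact this s

/-- The derivative of the cotangent series. -/
theorem pi_mul_cot_sq (hx : x ∈ Complex.integerComplement) (hx1 : ‖x‖ < 1) :
    (Real.pi * Complex.cot (Real.pi * x)) ^ 2 = eisensteinSum 2 x - Real.pi ^ 2 := by
  have hopen : Complex.integerComplement ∈ 𝓝 x :=
    Complex.isOpen_compl_range_intCast.mem_nhds hx
  obtain ⟨b, hb, hb1⟩ := exists_between hx1
  have hb0 : 0 < b := (norm_nonneg x).trans_lt hb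
  -- On the ball of radius `b < 1` the poles `±(n + 1)` stay at distance at least `(1 - b)(n + 1)`,
  -- which gives the majorant for termwise differentiation.
  have hpos (n : ℕ) (y : ℂ) (hy : y ∈ Metric.ball (0 : ℂ) b) :
      (1 - b) * (n + 1) ≤ ‖y - (n + 1)‖ ∧ (1 - b) * (n + 1) ≤ ‖y + (n + 1)‖ := by
    have h1 : ‖y‖ < b := by simpa using hy
    have h2 : ‖(n + 1 : ℂ)‖ = n + 1 := by exact_mod_cast Complex.norm_natCast (n + 1)
    have h3 := norm_sub_norm_le (n + 1 : ℂ) y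
    have h4 := norm_sub_norm_le (n + 1 : ℂ) (-y)
    rw [norm_sub_rev] at h3
    rw [sub_neg_eq_add, norm_neg, add_comm (n + 1 : ℂ)] at h4
    constructor <;> nlinarith
  have hbpos (n : ℕ) : 0 < (1 - b) * ((n : ℝ) + 1) := mul_pos (by linarith) (by positivity)
  have hder : HasDerivAt (fun z ↦ ∑' n : ℕ, cotTerm z n)
      (∑' n : ℕ, (-((x - (n + 1)) ^ 2)⁻¹ + -((x + (n + 1)) ^ 2)⁻¹)) x := by
    refine hasDerivAt_tsum_of_isPreconnected (t := Metric.ball 0 b) (y₀ := x)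
      (g' := fun (n : ℕ) (x : ℂ) ↦ -((x - (n + 1)) ^ 2)⁻¹ + -((x + (n + 1)) ^ 2)⁻¹)
      (u := fun n : ℕ ↦ 2 * ((1 - b) ^ 2)⁻¹ * (((n + 1 : ℕ) : ℝ) ^ 2)⁻¹) ?_ Metric.isOpen_ball
      (convex_ball _ _).isPreconnected (fun n y hy ↦ ?_) (fun n y hy ↦ ?_) (by simpa using hb)
      (summable_cotTerm hx) (by simpa using hb)
    · exact ((summable_nat_add_iff 1).mpr (Real.summable_nat_pow_inv.mpr one_lt_two)).mul_left _
    · have h1 : y - (n + 1) ≠ 0 := norm_pos_iff.mp ((hbpos n).trans_le (hpos n y hy).1)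
      have h2 : y + (n + 1) ≠ 0 := norm_pos_iff.mp ((hbpos n).trans_le (hpos n y hy).2)
      have := (((hasDerivAt_id y).sub_const ((n : ℂ) + 1)).inv h1).add
          (((hasDerivAt_id y).add_const ((n : ℂ) + 1)).inv h2)
      simp only [id_eq, neg_div, one_div] at this
      refine this.congr_of_eventuallyEq (.of_eq ?_)
      ext z
      simp [cotTerm]
    · refine (norm_add_le _ _).trans ?_
      rw [norm_neg, norm_neg, norm_inv, norm_inv, norm_pow, norm_pow, mul_assoc, ← mul_inv,
        ← mul_pow, two_mul]
      push_cast
      have := hbpos n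
      gcongr
      exacts [(hpos n y hy).1, (hpos n y hy).2]
  have hsin : Complex.sin (Real.pi * x) ≠ 0 := sin_pi_mul_ne_zero hx
  have hx0 : x ≠ 0 := Complex.integerComplement.ne_zero hx
  -- The square enters through `cot' = -(1 + cot²)`.
  have hcot : HasDerivAt (fun z ↦ (Real.pi : ℂ) * Complex.cot (Real.pi * z) - 1 / z)
      (-Real.pi ^ 2 * (1 + Complex.cot (Real.pi * x) ^ 2) + (x ^ 2)⁻¹) x := by
    have hl : HasDerivAt (fun z : ℂ ↦ (Real.pi : ℂ) * z) Real.pi x := by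
      simpa using (hasDerivAt_id x).const_mul (Real.pi : ℂ)
    have h1 := ((hl.ccos.div hl.csin hsin).const_mul (Real.pi : ℂ)).sub (hasDerivAt_inv hx0)
    convert! h1 using 1
    · ext z
      simp [Complex.cot]
    · rw [Complex.cot]
      field_simp
      ring
  have heq : (fun z ↦ ∑' n : ℕ, cotTerm z n) =ᶠ[𝓝 x]
      fun z ↦ (Real.pi : ℂ) * Complex.cot (Real.pi * z) - 1 / z := by
    filter_upwards [hopen] with z hz using (cot_series_rep' hz).symm
  have huniq := (hder.congr_of_eventuallyEq heq.symm).unique hcot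
  have hs := summable_inv_add_intCast_pow x le_rfl
  have hs1 : Summable fun n : ℕ ↦ ((x + (n : ℤ)) ^ 2)⁻¹ := hs.int_natCast
  have hs2 : Summable fun n : ℕ ↦ ((x + (-((n : ℤ) + 1) : ℤ)) ^ 2)⁻¹ :=
    hs.int_neg_natCast_add_one
  have hs3 : Summable fun n : ℕ ↦ ((x + (n + 1)) ^ 2)⁻¹ := by
    simpa using (summable_nat_add_iff 1).mpr hs1
  have hsum : eisensteinSum 2 x = (x ^ 2)⁻¹ -
      ∑' n : ℕ, (-((x - (n + 1)) ^ 2)⁻¹ + -((x + (n + 1)) ^ 2)⁻¹) := by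
    rw [eisensteinSum, tsum_of_nat_of_neg_add_one (f := fun j : ℤ ↦ ((x + j) ^ 2)⁻¹) hs1 hs2, hs1.tsum_eq_zero_add]
    have e (n : ℕ) : x + (-((n : ℤ) + 1) : ℤ) = x - (n + 1) := by push_cast; ring
    simp only [e] at hs2 ⊢
    simp only [← neg_add, tsum_neg, sub_neg_eq_add, hs2.tsum_add hs3]
    push_cast
    rw [add_zero]
    ring
  rw [hsum, huniq]
  ring

end EisensteinSums

/-! ### Special values of Hurwitz zeta functions. -/

section HurwitzValues

lemma rpow_neg_le_inv_add_inv_sq {b s : ℝ} (hb : 0 < b) (hs : s ∈ Set.Icc 1 2) :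
    b ^ (-s) ≤ b⁻¹ + (b ^ 2)⁻¹ := by
  rcases le_total 1 b with h | h
  · have := Real.rpow_le_rpow_of_exponent_le h (neg_le_neg hs.1)
    rw [Real.rpow_neg_one] at this
    have : 0 < (b ^ 2)⁻¹ := by positivity
    linarith
  · have := Real.rpow_le_rpow_of_exponent_ge hb h (neg_le_neg hs.2)
    rw [Real.rpow_neg hb.le 2, Real.rpow_two] at this
    have : 0 < b⁻¹ := by positivity
    linarith

/-- Factor out `b ^ (-s)`; since `b / c ≤ 1` and `s ≤ 2`, the rest is at most `1 - (b / c)² ≤ 2 (1 -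
b / c) ≤ 2 / c`. -/
lemma rpow_neg_sub_rpow_neg_le {b c s : ℝ} (hb : 0 < b) (hbc : b ≤ c) (hc : c ≤ b + 1)
    (hs : s ∈ Set.Icc 1 2) : |b ^ (-s) - c ^ (-s)| ≤ (b⁻¹ + (b ^ 2)⁻¹) * (2 * c⁻¹) := by
  have hc0 : 0 < c := hb.trans_le hbc
  have h1 : b ^ (-s) - c ^ (-s) = b ^ (-s) * (1 - (b / c) ^ s) := by
    rw [Real.div_rpow hb.le hc0.le, Real.rpow_neg hb.le, Real.rpow_neg hc0.le]
    have := (Real.rpow_pos_of_pos hb s).ne'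
    have := (Real.rpow_pos_of_pos hc0 s).ne'
    field_simp
  have hd : b / c ≤ 1 := (div_le_one hc0).mpr hbc
  have h2 : (b / c) ^ s ≤ 1 := Real.rpow_le_one (by positivity) hd (by linarith [hs.1])
  have h3 : (b / c) ^ 2 ≤ (b / c) ^ s := by
    rw [← Real.rpow_two]
    exact Real.rpow_le_rpow_of_exponent_ge (by positivity) hd hs.2
  have h4 : 1 - (b / c) ^ 2 ≤ 2 * c⁻¹ := by
    have : 1 - b / c ≤ c⁻¹ := by
      rw [one_sub_div hc0.ne', div_eq_mul_inv]
      exact mul_le_of_le_one_left (by positivity) (by linarith)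
    have h0 : 0 ≤ b / c := by positivity
    nlinarith
  rw [h1, abs_of_nonneg (mul_nonneg (by positivity) (by linarith))]
  exact mul_le_mul (rpow_neg_le_inv_add_inv_sq hb hs) (by linarith) (by linarith) (by positivity)

/-- Supplies a summable majorant, uniform in `s`, for letting `s` decrease to 1. -/
lemma abs_rpow_neg_sub_rpow_neg_le {b c s δ N : ℝ} (hδ : 0 < δ) (hN : 1 ≤ N) (hb : δ * N ≤ b)
    (hc : δ * N ≤ c) (h : |b - c| ≤ 1) (hs : s ∈ Set.Icc 1 2) :
    |b ^ (-s) - c ^ (-s)| ≤ (δ⁻¹ + (δ ^ 2)⁻¹) * (2 * δ⁻¹) * (N ^ 2)⁻¹ := by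
  wlog hbc : b ≤ c generalizing b c
  · rw [abs_sub_comm] at h ⊢
    exact this hc hb h (le_of_not_ge hbc)
  have hN0 : 0 < N := by linarith
  have hδN : 0 < δ * N := mul_pos hδ hN0
  have hb0 : 0 < b := hδN.trans_le hb
  have hc0 : 0 < c := hδN.trans_le hc
  refine (rpow_neg_sub_rpow_neg_le hb0 hbc (by linarith [(abs_le.mp h).1]) hs).trans ?_
  have h1 : b⁻¹ ≤ δ⁻¹ * N⁻¹ := by rw [← mul_inv]; gcongr
  have h2 : (b ^ 2)⁻¹ ≤ (δ ^ 2)⁻¹ * N⁻¹ := by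
    rw [← mul_inv]
    gcongr
    calc δ ^ 2 * N ≤ δ ^ 2 * N * N := le_mul_of_one_le_right (by positivity) hN
      _ = (δ * N) ^ 2 := by ring
      _ ≤ b ^ 2 := by gcongr
  have h3 : c⁻¹ ≤ δ⁻¹ * N⁻¹ := by rw [← mul_inv]; gcongr
  calc (b⁻¹ + (b ^ 2)⁻¹) * (2 * c⁻¹)
      ≤ (δ⁻¹ * N⁻¹ + (δ ^ 2)⁻¹ * N⁻¹) * (2 * (δ⁻¹ * N⁻¹)) := by gcongr
    _ = _ := by rw [pow_two N, mul_inv]; ring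

lemma ofReal_mem_integerComplement {a : ℝ} (ha : a ∈ Set.Ioo (0 : ℝ) 1) :
    (a : ℂ) ∈ Complex.integerComplement := by
  rintro ⟨n, hn⟩
  have hn' : (n : ℝ) = a := by exact_mod_cast hn
  rw [← hn'] at ha
  have h1 : 0 < n := by exact_mod_cast ha.1
  have h2 : n < 1 := by exact_mod_cast ha.2
  lia

/-- The value at `1` of the odd Hurwitz zeta function. -/
theorem hurwitzZetaOdd_one {a : ℝ} (ha : a ∈ Set.Ioo (0 : ℝ) 1) :
    HurwitzZeta.hurwitzZetaOdd a 1 = Real.pi * Complex.cot (Real.pi * a) / 2 := by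
  set δ := min a (1 - a) with hδdef
  have hδ : 0 < δ := lt_min ha.1 (by linarith [ha.2])
  let C : ℝ := (δ⁻¹ + (δ ^ 2)⁻¹) * (2 * δ⁻¹)
  let u : ℕ → ℝ := fun n ↦ C * (((n + 1 : ℕ) : ℝ) ^ 2)⁻¹
  have hu : Summable u :=
    ((summable_nat_add_iff 1).mpr (Real.summable_nat_pow_inv.mpr one_lt_two)).mul_left _
  let F : ℝ → ℕ → ℝ := fun s n ↦ (n + a) ^ (-s) - (n + 1 - a) ^ (-s)
  have hpos (n : ℕ) : 0 < (n : ℝ) + a ∧ 0 < (n : ℝ) + 1 - a :=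
    ⟨by linarith [ha.1, n.cast_nonneg (α := ℝ)], by linarith [ha.2, n.cast_nonneg (α := ℝ)]⟩
  have hbound (s : ℝ) (hs : s ∈ Set.Icc 1 2) (n : ℕ) : ‖((F s n : ℝ) : ℂ)‖ ≤ u n := by
    rw [Complex.norm_real, Real.norm_eq_abs]
    have h1 : δ ≤ a := min_le_left _ _
    have h2 : δ ≤ 1 - a := min_le_right _ _
    have hn := n.cast_nonneg (α := ℝ)
    refine abs_rpow_neg_sub_rpow_neg_le hδ (by simp) ?_ ?_ ?_ hs
    · push_cast
      nlinarith [ha.2]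
    · push_cast
      nlinarith [ha.1]
    · rw [abs_le]
      constructor <;> linarith [ha.1, ha.2]
  -- The series formula is available only for `s > 1`, so the value at 1 is reached as a one-sided
  -- limit by dominated convergence.
  have hlim : Tendsto (fun s : ℝ ↦ ∑' n, ((F s n : ℝ) : ℂ)) (𝓝[>] 1) (𝓝 (∑' n, ((F 1 n : ℝ) : ℂ))) := by
    refine tendsto_tsum_of_dominated_convergence hu (fun n ↦ ?_) ?_
    · refine ((Complex.continuous_ofReal.tendsto _).comp ?_)
      refine tendsto_nhdsWithin_of_tendsto_nhds (Continuous.tendsto ?_ 1)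
      have := (hpos n).1.ne'
      have := (hpos n).2.ne'
      exact (Real.continuous_const_rpow ‹_› |>.comp continuous_neg).sub
        (Real.continuous_const_rpow ‹_› |>.comp continuous_neg)
    · filter_upwards [Ioc_mem_nhdsGT one_lt_two] with s hs n using
        hbound s ⟨hs.1.le, hs.2⟩ n
  have hval : (fun s : ℝ ↦ ∑' n, ((F s n : ℝ) : ℂ)) =ᶠ[𝓝[>] 1]
      fun s : ℝ ↦ 2 * HurwitzZeta.hurwitzZetaOdd a s := by
    filter_upwards [self_mem_nhdsWithin] with s hs
    have h := (HurwitzZeta.hasSum_nat_hurwitzZetaOdd_of_mem_Icc (a := a) ⟨ha.1.le, ha.2.le⟩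
      (s := s) hs).mul_left 2
    rw [← h.tsum_eq]
    refine tsum_congr fun n ↦ ?_
    rw [mul_div_cancel₀ _ two_ne_zero, Complex.ofReal_sub, Complex.ofReal_cpow (hpos n).1.le,
      Complex.ofReal_cpow (hpos n).2.le]
    push_cast
    rw [Complex.cpow_neg, Complex.cpow_neg, one_div, one_div]
  have hcont : Tendsto (fun s : ℝ ↦ 2 * HurwitzZeta.hurwitzZetaOdd a s) (𝓝[>] 1)
      (𝓝 (2 * HurwitzZeta.hurwitzZetaOdd a (1 : ℝ))) :=
    tendsto_nhdsWithin_of_tendsto_nhds (Continuous.tendsto (by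
      have := (HurwitzZeta.differentiable_hurwitzZetaOdd a).continuous
      fun_prop) 1)
  have hsum1 : Summable fun n ↦ ((F 1 n : ℝ) : ℂ) :=
    .of_norm_bounded hu (hbound 1 ⟨le_rfl, one_le_two⟩)
  have hx := ofReal_mem_integerComplement ha
  have hcot : HasSum (fun n ↦ ((F 1 n : ℝ) : ℂ)) (Real.pi * Complex.cot (Real.pi * a)) := by
    refine hsum1.hasSum_iff_tendsto_nat.mpr ?_
    -- The cotangent series pairs the poles `±(n + 1)`, whereas `F` pairs `n` with `-(n + 1)`. The
    -- partial sums differ by the telescoping `1 / a - 1 / (a + N)`.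
    have h1 := (tendsto_logDeriv_euler_cot_sub hx).add
      ((EisensteinSeries.tendsto_zero_inv_linear a 1).const_sub (1 / (a : ℂ)))
    rw [sub_zero, sub_add_cancel] at h1
    refine h1.congr fun N ↦ ?_
    have h2 := Finset.sum_range_sub' (fun n : ℕ ↦ 1 / ((a : ℂ) + (n : ℂ))) N
    simp only [Int.cast_one, one_mul, Nat.cast_zero, add_zero] at h2 ⊢
    rw [← h2, ← Finset.sum_add_distrib]
    refine Finset.sum_congr rfl fun n _ ↦ ?_
    simp only [F, Real.rpow_neg_one, cotTerm]
    push_cast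
    rw [show (a : ℂ) - (n + 1) = -(n + 1 - a) by ring, show (a : ℂ) + n = n + a by ring]
    simp only [one_div, inv_neg]
    ring
  have := tendsto_nhds_unique (hlim.congr' hval) hcont
  rw [hcot.tsum_eq] at this
  rw [this]
  simp

/-- The values of the even Hurwitz zeta function at even positive integers. -/
theorem hurwitzZetaEven_two_mul {a : ℝ} {r : ℕ} (hr : 1 ≤ r) :
    HurwitzZeta.hurwitzZetaEven a (2 * r : ℕ) = eisensteinSum (2 * r) a / 2 := by
  have h := HurwitzZeta.hasSum_int_hurwitzZetaEven a (s := (2 * r : ℕ))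
    (by rw [Complex.natCast_re]; exact_mod_cast (by lia : 1 < 2 * r))
  refine h.unique (((hasSum_eisensteinSum a (by lia)).div_const 2).congr_fun fun n ↦ ?_)
  rw [Complex.cpow_natCast, one_div, ← Complex.ofReal_pow, (even_two_mul r).pow_abs]
  push_cast
  rw [add_comm]

/-- The square of the odd Hurwitz zeta function at `1` times a value of the even one. -/
theorem four_mul_hurwitzZetaOdd_one_sq_mul {a : ℝ} (ha : a ∈ Set.Ioo (0 : ℝ) 1) {r : ℕ}
    (hr : 1 ≤ r) :
    4 * HurwitzZeta.hurwitzZetaOdd a 1 ^ 2 * HurwitzZeta.hurwitzZetaEven a (2 * r : ℕ) =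
      HurwitzZeta.hurwitzZetaEven a (2 * (r + 1) : ℕ) +
      2 * riemannZeta (2 * r : ℕ) * HurwitzZeta.hurwitzZetaEven a (2 * 1 : ℕ) +
      (∑ i ∈ Finset.range r, (2 * i + 1) * (2 * riemannZeta (2 * (i + 1) : ℕ)) *
        HurwitzZeta.hurwitzZetaEven a (2 * (r - i) : ℕ)) -
      Real.pi ^ 2 * HurwitzZeta.hurwitzZetaEven a (2 * r : ℕ) := by
  have hx := ofReal_mem_integerComplement ha
  have hcot := pi_mul_cot_sq hx (by
    rw [Complex.norm_real, Real.norm_eq_abs, abs_of_pos ha.1]; exact ha.2)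
  have hmul := eisensteinSum_two_mul_even hx hr
  have hsum : ∑ i ∈ Finset.range r, (2 * i + 1) * (2 * riemannZeta (2 * (i + 1) : ℕ)) *
      HurwitzZeta.hurwitzZetaEven a (2 * (r - i) : ℕ) =
      (∑ i ∈ Finset.range r, (2 * i + 1) * (2 * riemannZeta (2 * i + 2 : ℕ)) *
        eisensteinSum (2 * r - 2 * i) a) / 2 := by
    rw [Finset.sum_div]
    refine Finset.sum_congr rfl fun i hi ↦ ?_
    rw [hurwitzZetaEven_two_mul (by have := Finset.mem_range.mp hi; lia), Nat.mul_sub, mul_add 2 i 1]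
    ring
  rw [hsum, hurwitzZetaOdd_one ha, hurwitzZetaEven_two_mul hr, hurwitzZetaEven_two_mul le_rfl,
    hurwitzZetaEven_two_mul (by lia), mul_one, mul_add 2 r 1, div_pow, hcot]
  linear_combination hmul / 2

end HurwitzValues

/-! ### Jordan totients from the trivial character. -/

section JordanTotient

/-- Sums of even Hurwitz zeta values over the units modulo `q`. -/
theorem sum_units_hurwitzZetaEven (q : ℕ) [NeZero q] {m : ℕ} (hm : 1 < m) :
    ∑ j : ZMod q, (1 : DirichletCharacter ℂ q) j *
      HurwitzZeta.hurwitzZetaEven (ZMod.toAddCircle j) m = riemannZeta m * jordanTotient m q := by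
  have hq : (q : ℂ) ≠ 0 := NeZero.ne _
  -- The trivial L-function is evaluated twice: by removing Euler factors from `ζ`, and as a Hurwitz
  -- combination.
  have h1 : DirichletCharacter.LFunctionTrivChar q m = _ :=
    DirichletCharacter.LFunctionTrivChar_eq_mul_riemannZeta (s := m) (by exact_mod_cast hm.ne')
  have h2 : DirichletCharacter.LFunctionTrivChar q m = _ :=
    ZMod.LFunction_def_even (Φ := (1 : DirichletCharacter ℂ q))
      (DirichletCharacter.Even.to_fun (MulChar.one_apply isUnit_neg_one)) m
  rw [h2, Complex.cpow_neg, Complex.cpow_natCast, inv_mul_eq_iff_eq_mul₀ (pow_ne_zero _ hq)] at h1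
  rw [h1, jordanTotient]
  push_cast
  simp only [Complex.cpow_neg, Complex.cpow_natCast, one_div]
  ring

end JordanTotient

/-! ### Character orthogonality and the mean value. -/

section MeanValue

variable {q : ℕ} [NeZero q]

lemma mem_charsOfParity_one {χ : DirichletCharacter ℂ q} : χ ∈ charsOfParity q 1 ↔ χ.Odd := by
  simp [charsOfParity, DirichletCharacter.Odd]

lemma DirichletCharacter.Odd.LFunction_one {χ : DirichletCharacter ℂ q} (hχ : χ.Odd) :
    DirichletCharacter.LFunction χ 1 =
      (q : ℂ)⁻¹ * ∑ j, χ j * HurwitzZeta.hurwitzZetaOdd (ZMod.toAddCircle j) 1 := by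
  rw [DirichletCharacter.LFunction, ZMod.LFunction_def_odd hχ.to_fun, Complex.cpow_neg_one]

/-- This allows the parity restriction on the characters to be dropped before orthogonality is
applied. -/
lemma DirichletCharacter.sum_mul_hurwitzZetaOdd_eq_zero {χ : DirichletCharacter ℂ q}
    (hχ : ¬ χ.Odd) (s : ℂ) :
    ∑ j, χ j * HurwitzZeta.hurwitzZetaOdd (ZMod.toAddCircle j) s = 0 := by
  have he : χ.Even := χ.even_or_odd.resolve_right hχ
  refine Function.Odd.sum_eq_zero fun j ↦ ?_
  rw [map_neg (ZMod.toAddCircle (N := q)), HurwitzZeta.hurwitzZetaOdd_neg, he.to_fun j, mul_neg]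

lemma DirichletCharacter.Odd.LFunction_star_mul {χ₁ χ₂ : DirichletCharacter ℂ q} (h₁ : χ₁.Odd)
    (h₂ : χ₂.Odd) (n : ℕ) :
    DirichletCharacter.LFunction (star (χ₁ * χ₂)) n = ((q : ℂ) ^ n)⁻¹ *
      ∑ j, χ₁⁻¹ j * χ₂⁻¹ j * HurwitzZeta.hurwitzZetaEven (ZMod.toAddCircle j) n := by
  have he : (star (χ₁ * χ₂)).Even := by
    rw [DirichletCharacter.Even, MulChar.star_apply, MulChar.mul_apply, h₁, h₂]
    simp
  rw [DirichletCharacter.LFunction, ZMod.LFunction_def_even he.to_fun, Complex.cpow_neg,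
    Complex.cpow_natCast, MulChar.star_eq_inv, mul_inv]
  rfl

lemma DirichletCharacter.sum_inv_mul_sum (f : ZMod q → ℂ) (j : ZMod q) :
    ∑ χ : DirichletCharacter ℂ q, χ⁻¹ j * ∑ b, χ b * f b =
      (1 : DirichletCharacter ℂ q) j * (q.totient * f j) := by
  by_cases hj : IsUnit j
  · have h (χ : DirichletCharacter ℂ q) : χ⁻¹ j = χ j⁻¹ := by
      obtain ⟨u, rfl⟩ := hj
      rw [MulChar.inv_apply, Ring.inverse_unit, ZMod.inv_coe_unit]
    simp only [h, Finset.mul_sum, ← mul_assoc]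
    rw [Finset.sum_comm]
    simp only [← Finset.sum_mul, DirichletCharacter.sum_char_inv_mul_char_eq ℂ hj]
    simp [MulChar.one_apply hj]
  · simp [MulChar.map_nonunit _ hj]

/-- The mean value as a sum of Hurwitz zeta values. -/
theorem meanV_one_one_eq (n : ℕ) :
    meanV q 1 1 n 1 1 1 = (q.totient : ℂ) ^ 2 * ((q : ℂ) ^ (n + 2))⁻¹ *
      ∑ j : ZMod q, (1 : DirichletCharacter ℂ q) j *
        (HurwitzZeta.hurwitzZetaOdd (ZMod.toAddCircle j) 1 ^ 2 *
          HurwitzZeta.hurwitzZetaEven (ZMod.toAddCircle j) n) := by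
  classical
  set A : DirichletCharacter ℂ q → ℂ := fun χ ↦
    ∑ j, χ j * HurwitzZeta.hurwitzZetaOdd (ZMod.toAddCircle j) 1 with hA
  have hA0 (χ : DirichletCharacter ℂ q) (hχ : ¬ χ.Odd) : A χ = 0 :=
    χ.sum_mul_hurwitzZetaOdd_eq_zero hχ 1
  set H : ZMod q → ℂ := fun j ↦ HurwitzZeta.hurwitzZetaEven (ZMod.toAddCircle j) n with hH
  have h1 : meanV q 1 1 n 1 1 1 = ∑ χ₁, ∑ χ₂, ((q : ℂ) ^ (n + 2))⁻¹ *
      (A χ₁ * A χ₂ * ∑ j, χ₁⁻¹ j * χ₂⁻¹ j * H j) := by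
    simp only [meanV, mem_charsOfParity_one, Finset.sum_filter]
    refine Finset.sum_congr rfl fun χ₁ _ ↦ ?_
    split_ifs with hχ₁
    · refine Finset.sum_congr rfl fun χ₂ _ ↦ ?_
      split_ifs with hχ₂
      · rw [hχ₁.LFunction_star_mul hχ₂]
        simp only [Int.cast_one, map_one, mul_one, Nat.cast_one, hχ₁.LFunction_one,
          hχ₂.LFunction_one, one_mul, pow_add, mul_inv, pow_two, hA, hH]
        ring
      · simp [hA0 χ₂ hχ₂]
    · simp [hA0 χ₁ hχ₁]
  -- For fixed `j` the two character sums separate, which makes a perfect square.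
  have h2 : ∑ χ₁, ∑ χ₂, (A χ₁ * A χ₂ * ∑ j, χ₁⁻¹ j * χ₂⁻¹ j * H j) =
      ∑ j, (∑ χ : DirichletCharacter ℂ q, χ⁻¹ j * A χ) ^ 2 * H j := by
    have h (j : ZMod q) : (∑ χ : DirichletCharacter ℂ q, χ⁻¹ j * A χ) ^ 2 * H j =
        ∑ χ₁ : DirichletCharacter ℂ q, ∑ χ₂ : DirichletCharacter ℂ q,
          A χ₁ * A χ₂ * (χ₁⁻¹ j * χ₂⁻¹ j * H j) := by
      rw [pow_two, Finset.sum_mul_sum, Finset.sum_mul]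
      refine Finset.sum_congr rfl fun χ₁ _ ↦ ?_
      rw [Finset.sum_mul]
      refine Finset.sum_congr rfl fun χ₂ _ ↦ ?_
      ring
    simp only [h]
    symm
    rw [Finset.sum_comm]
    refine Finset.sum_congr rfl fun χ₁ _ ↦ ?_
    rw [Finset.sum_comm]
    refine Finset.sum_congr rfl fun χ₂ _ ↦ ?_
    exact (Finset.mul_sum ..).symm
  have h3 (j : ZMod q) : ∑ χ : DirichletCharacter ℂ q, χ⁻¹ j * A χ =
      (1 : DirichletCharacter ℂ q) j *
        (q.totient * HurwitzZeta.hurwitzZetaOdd (ZMod.toAddCircle j) 1) :=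
    DirichletCharacter.sum_inv_mul_sum _ j
  rw [h1]
  simp only [← Finset.mul_sum]
  rw [h2, mul_assoc, mul_left_comm]
  congr 1
  rw [Finset.mul_sum]
  refine Finset.sum_congr rfl fun j _ ↦ ?_
  rw [h3]
  by_cases hj : IsUnit j
  · rw [MulChar.one_apply hj]
    ring
  · rw [MulChar.map_nonunit _ hj]
    ring

/-- The mean value in terms of zeta values and Jordan totients. -/
theorem meanV_one_one_even (hq : 2 ≤ q) {r : ℕ} (hr : 1 ≤ r) :
    meanV q 1 1 (2 * r) 1 1 1 = (q.totient : ℂ) ^ 2 / (4 * (q : ℂ) ^ (2 * r + 2)) *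
      (riemannZeta (2 * (r + 1) : ℕ) * jordanTotient (2 * (r + 1)) q +
      2 * riemannZeta (2 * r : ℕ) * (riemannZeta (2 * 1 : ℕ) * jordanTotient (2 * 1) q) +
      (∑ i ∈ Finset.range r, (2 * i + 1) * (2 * riemannZeta (2 * (i + 1) : ℕ)) *
        (riemannZeta (2 * (r - i) : ℕ) * jordanTotient (2 * (r - i)) q)) -
      Real.pi ^ 2 * (riemannZeta (2 * r : ℕ) * jordanTotient (2 * r) q)) := by
  have key (j : ZMod q) : (1 : DirichletCharacter ℂ q) j *
        (HurwitzZeta.hurwitzZetaOdd (ZMod.toAddCircle j) 1 ^ 2 *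
          HurwitzZeta.hurwitzZetaEven (ZMod.toAddCircle j) (2 * r : ℕ)) = 4⁻¹ *
      ((1 : DirichletCharacter ℂ q) j *
        HurwitzZeta.hurwitzZetaEven (ZMod.toAddCircle j) (2 * (r + 1) : ℕ) +
      2 * riemannZeta (2 * r : ℕ) * ((1 : DirichletCharacter ℂ q) j *
        HurwitzZeta.hurwitzZetaEven (ZMod.toAddCircle j) (2 * 1 : ℕ)) +
      (∑ i ∈ Finset.range r, (2 * i + 1) * (2 * riemannZeta (2 * (i + 1) : ℕ)) *
        ((1 : DirichletCharacter ℂ q) j *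
          HurwitzZeta.hurwitzZetaEven (ZMod.toAddCircle j) (2 * (r - i) : ℕ))) -
      Real.pi ^ 2 * ((1 : DirichletCharacter ℂ q) j *
        HurwitzZeta.hurwitzZetaEven (ZMod.toAddCircle j) (2 * r : ℕ))) := by
    by_cases hj : IsUnit j
    -- As `q ≥ 2`, a unit `j` is nonzero, so `j / q` avoids the pole of the cotangent.
    · have hqpos : (0 : ℝ) < q := by exact_mod_cast (by lia : 0 < q)
      have hj0 : j.val ≠ 0 := by
        rw [Ne, ZMod.val_eq_zero]
        rintro rfl
        have : Fact (1 < q) := ⟨hq⟩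
        exact not_isUnit_zero hj
      have ha : (j.val / q : ℝ) ∈ Set.Ioo (0 : ℝ) 1 :=
        ⟨div_pos (by exact_mod_cast Nat.pos_of_ne_zero hj0) hqpos,
          (div_lt_one hqpos).mpr (by exact_mod_cast j.val_lt)⟩
      have := four_mul_hurwitzZetaOdd_one_sq_mul ha hr
      rw [← ZMod.toAddCircle_apply] at this
      simp only [MulChar.one_apply hj, one_mul]
      linear_combination this / 4
    · simp [MulChar.map_nonunit _ hj]
  rw [meanV_one_one_eq]
  simp only [key, ← Finset.mul_sum, Finset.sum_add_distrib, Finset.sum_sub_distrib]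
  rw [Finset.sum_comm]
  simp only [← Finset.mul_sum]
  have hs : ∑ i ∈ Finset.range r, ((2 * i + 1) * (2 * riemannZeta (2 * (i + 1) : ℕ)) *
        ∑ j : ZMod q, ((1 : DirichletCharacter ℂ q) j *
          HurwitzZeta.hurwitzZetaEven (ZMod.toAddCircle j) (2 * (r - i) : ℕ))) =
      ∑ i ∈ Finset.range r, (2 * i + 1) * (2 * riemannZeta (2 * (i + 1) : ℕ)) *
        (riemannZeta (2 * (r - i) : ℕ) * jordanTotient (2 * (r - i)) q) := by
    refine Finset.sum_congr rfl fun i hi ↦ ?_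
    rw [sum_units_hurwitzZetaEven q (by have := Finset.mem_range.mp hi; lia)]
  rw [hs, sum_units_hurwitzZetaEven q (by lia), sum_units_hurwitzZetaEven q (by lia),
    sum_units_hurwitzZetaEven q (by lia)]
  rw [div_eq_mul_inv, mul_inv]
  ring

end MeanValue

/-! ### Quadratic recurrences for Bernoulli numbers. -/

section Bernoulli

/-- The coefficients `B₂ₖ / (2k)!` of the even part of `t / (eᵗ - 1)`. -/
noncomputable def evenBernoulliCoeff (k : ℕ) : ℚ := bernoulli (2 * k) / (2 * k).factorial

open PowerSeries in
/-- The quadratic recurrence for Bernoulli numbers, including the odd indices. -/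
lemma sum_antidiagonal_bernoulli_mul (n : ℕ) :
    ∑ p ∈ Finset.HasAntidiagonal.antidiagonal (n + 1), bernoulli p.1 / (p.1).factorial *
      (bernoulli p.2 / (p.2).factorial) = -n * (bernoulli (n + 1) / (n + 1).factorial) -
        bernoulli n / n.factorial := by
  set B : PowerSeries ℚ := bernoulliPowerSeries ℚ with hB
  have h1 : B * (exp ℚ - 1) = X := bernoulliPowerSeries_mul_exp_sub_one ℚ
  have h2 : d⁄dX ℚ B * (exp ℚ - 1) + B * exp ℚ = 1 := by
    have := congrArg (d⁄dX ℚ) h1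
    rw [Derivation.leibniz, map_sub, derivative_exp, derivative_X] at this
    simp only [smul_eq_mul, Derivation.map_one_eq_zero, sub_zero] at this
    linear_combination this
  -- The differential equation of `t / (eᵗ - 1)`: multiply `h2` by `B` and eliminate the exponential
  -- with `h1`.
  have h3 : B * B = B - X * B - X * d⁄dX ℚ B := by
    linear_combination B * h2 - (B + d⁄dX ℚ B) * h1
  have h4 := congrArg (coeff (n + 1)) h3
  have hc (k : ℕ) : coeff k B = bernoulli k / k.factorial := by
    simp [hB, bernoulliPowerSeries]
  rw [coeff_mul, map_sub, map_sub, coeff_succ_X_mul, coeff_succ_X_mul, coeff_derivative] at h4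
  simp only [hc] at h4
  rw [h4]
  ring

/-- Euler's quadratic recurrence for Bernoulli numbers. -/
theorem sum_evenBernoulliCoeff_mul (p : ℕ) :
    ∑ i ∈ Finset.range (p + 1), evenBernoulliCoeff (i + 1) * evenBernoulliCoeff (p + 1 - i) =
      -(2 * p + 5) * evenBernoulliCoeff (p + 2) := by
  have h := sum_antidiagonal_bernoulli_mul (2 * p + 3)
  rw [Finset.Nat.sum_antidiagonal_eq_sum_range_succ
    (fun i j ↦ bernoulli i / i.factorial * (bernoulli j / j.factorial)),
    bernoulli_eq_zero_of_odd (n := 2 * p + 3) ⟨p + 1, by ring⟩ (by lia), zero_div, sub_zero] at h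
  rw [← Finset.sum_of_injOn (s := Finset.range (p + 3)) (fun s ↦ 2 * s)
    (fun a _ b _ hab ↦ by simpa using hab)
    (fun s hs ↦ by simp only [Finset.coe_range, Set.mem_Iio] at hs ⊢; lia)
    (f := fun s ↦ evenBernoulliCoeff s * evenBernoulliCoeff (p + 2 - s)) ?_ ?_] at h
  -- The two end terms each equal `evenBernoulliCoeff (p + 2)`, which shifts `2p + 3` to `2p + 5`.
  · rw [Finset.sum_range_succ, Finset.sum_range_succ'] at h
    have h0 : evenBernoulliCoeff 0 = 1 := by simp [evenBernoulliCoeff]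
    have hp : evenBernoulliCoeff (p + 2) =
        bernoulli (2 * p + 3 + 1) / (2 * p + 3 + 1).factorial := rfl
    simp only [h0, tsub_zero, tsub_self, one_mul, mul_one, ← hp, Nat.cast_add, Nat.cast_mul,
      Nat.cast_ofNat] at h
    have : ∀ i, p + 2 - (i + 1) = p + 1 - i := by lia
    simp only [this] at h
    linear_combination h
  · intro k hk hk'
    simp only [Finset.mem_range] at hk
    rcases Nat.even_or_odd' k with ⟨s, rfl | rfl⟩
    · exact absurd ⟨s, by simp only [Finset.coe_range, Set.mem_Iio]; lia, rfl⟩ hk'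
    -- `B₁` is nonzero, but its partner has odd index `2p + 3`.
    · rcases Nat.eq_zero_or_pos s with rfl | hs
      · rw [bernoulli_eq_zero_of_odd (n := 2 * p + 3 + 1 - (2 * 0 + 1)) ⟨p + 1, by lia⟩ (by lia)]
        simp
      · rw [bernoulli_eq_zero_of_odd (n := 2 * s + 1) ⟨s, rfl⟩ (by lia)]
        simp
  · intro s hs
    simp only [evenBernoulliCoeff]
    rw [show 2 * (p + 2 - s) = 2 * p + 3 + 1 - 2 * s by lia]

lemma evenBernoulliCoeff_one : evenBernoulliCoeff 1 = 1 / 12 := by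
  norm_num [evenBernoulliCoeff, bernoulli_two]

lemma riemannZeta_eq_evenBernoulliCoeff {k : ℕ} (hk : 1 ≤ k) :
    riemannZeta (2 * k : ℕ) = (-1) ^ (k + 1) * (2 * (Real.pi : ℂ)) ^ (2 * k) / 2 *
      (evenBernoulliCoeff k : ℂ) := by
  have := riemannZeta_two_mul_nat (k := k) (by lia)
  push_cast
  rw [this, evenBernoulliCoeff, mul_pow]
  obtain ⟨l, rfl⟩ : ∃ l, k = l + 1 := ⟨k - 1, by lia⟩
  rw [show 2 * (l + 1) - 1 = 2 * l + 1 by lia]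
  push_cast
  ring

end Bernoulli

/-! ### Normal forms of `M₁`, `M₂`, `M₃`. -/

section Terms

lemma termM₁_eq (q R : ℕ) : termM₁ q (2 * (R + 1)) = (2 * (R + 1)).factorial *
    ∑ s ∈ Finset.range (R + 1), 2 * (evenBernoulliCoeff (s + 1) *
      jordanTotient (2 * (s + 1)) q * evenBernoulliCoeff (R - s + 1)) := by
  rw [termM₁, Finset.mul_sum, Finset.mul_sum, show 2 * (R + 1) / 2 = R + 1 by lia]
  symm
  refine Finset.sum_of_injOn (fun s ↦ s + 1) (fun a _ b _ hab ↦ by simpa using hab)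
    (fun s hs ↦ by
      simp only [Finset.coe_range, Set.mem_Iio, Finset.coe_Icc, Set.mem_Icc] at hs ⊢; lia) ?_ ?_
  · intro k hk hk'
    rw [Finset.mem_Icc] at hk
    exact absurd ⟨k - 1, by simp only [Finset.coe_range, Set.mem_Iio]; lia, by simp only; lia⟩ hk'
  · intro s hs
    rw [Finset.mem_range] at hs
    obtain ⟨t, rfl⟩ : ∃ t, R = s + t := ⟨R - s, by lia⟩
    rw [show 2 * (s + t + 1) + 2 - 2 * (s + 1) = 2 * (t + 1) by lia, Nat.add_sub_cancel_left,
      show 2 * (s + t + 1) = 2 * (s + 1) + 2 * t by ring, Nat.cast_add_choose]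
    simp only [evenBernoulliCoeff]
    have h : (2 * (t + 1)).factorial = (2 * t + 2) * ((2 * t + 1) * (2 * t).factorial) := rfl
    have := Nat.factorial_ne_zero (2 * t)
    have := Nat.factorial_ne_zero (2 * (s + 1))
    have h1 : ((2 * (s + 1) + 2 * t : ℕ) : ℚ) + 2 - 2 * (s + 1 : ℕ) = 2 * t + 2 := by
      push_cast; ring
    have h2 : ((2 * (s + 1) + 2 * t : ℕ) : ℚ) + 1 - 2 * (s + 1 : ℕ) = 2 * t + 1 := by
      push_cast; ring
    rw [h, h1, h2]
    push_cast
    field_simp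

/-- Only `j = 2t + 3` and `l = 2(s + 1)` survive: any other parity produces a Bernoulli number of
odd index at least 3. The binomials and denominators recombine into factorials. -/
lemma termM₂_eq (q R : ℕ) : termM₂ q (2 * (R + 1)) = (2 * (R + 1)).factorial *
    ∑ t ∈ Finset.range R, ∑ s ∈ Finset.range (t + 1), evenBernoulliCoeff (s + 1) *
      jordanTotient (2 * (s + 1)) q * evenBernoulliCoeff (t - s + 1) *
        evenBernoulliCoeff (R - t) := by
  rw [termM₂, Finset.mul_sum]
  symm
  refine Finset.sum_of_injOn (fun t ↦ 2 * t + 3) (fun a _ b _ hab ↦ by simpa using hab)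
    (fun s hs ↦ by
      simp only [Finset.coe_range, Set.mem_Iio, Finset.coe_Icc, Set.mem_Icc] at hs ⊢; lia) ?_ ?_
  · intro k hk hk'
    rw [Finset.mem_Icc] at hk
    rcases Nat.even_or_odd' k with ⟨s, rfl | rfl⟩
    · rw [bernoulli_eq_zero_of_odd (n := 2 * (R + 1) + 1 - 2 * s) ⟨R + 1 - s, by lia⟩ (by lia)]
      simp
    · exact absurd ⟨s - 1, by simp only [Finset.coe_range, Set.mem_Iio]; lia, by simp only; lia⟩ hk'
  · intro t ht
    rw [Finset.mem_range] at ht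
    rw [Finset.mul_sum, Finset.mul_sum]
    refine Finset.sum_of_injOn (fun s ↦ 2 * (s + 1)) (fun a _ b _ hab ↦ by simpa using hab)
      (fun s hs ↦ by
        simp only [Finset.coe_range, Set.mem_Iio, Finset.coe_Icc, Set.mem_Icc] at hs ⊢; lia) ?_ ?_
    · intro k hk hk'
      rw [Finset.mem_Icc] at hk
      rcases Nat.even_or_odd' k with ⟨s, rfl | rfl⟩
      · exact absurd ⟨s - 1, by simp only [Finset.coe_range, Set.mem_Iio]; lia,
          by simp only; lia⟩ hk'
      · rw [bernoulli_eq_zero_of_odd (n := 2 * s + 1) ⟨s, rfl⟩ (by lia)]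
        simp
    · intro s hs
      rw [Finset.mem_range] at hs
      obtain ⟨u, rfl⟩ : ∃ u, t = s + u := ⟨t - s, by lia⟩
      obtain ⟨v, rfl⟩ : ∃ v, R = s + u + (v + 1) := ⟨R - (s + u) - 1, by lia⟩
      rw [show 2 * (s + u + (v + 1) + 1) + 1 - (2 * (s + u) + 3) = 2 * (v + 1) by lia,
        show 2 * (s + u) + 3 + 1 - 2 * (s + 1) = 2 * (u + 1) by lia, Nat.add_sub_cancel_left,
        Nat.add_sub_cancel_left,
        show 2 * (s + u + (v + 1) + 1) = 2 * (s + u) + 3 + (2 * v + 1) by ring,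
        Nat.cast_add_choose, show 2 * (s + u) + 3 = 2 * (s + 1) + (2 * u + 1) by ring,
        Nat.cast_add_choose]
      simp only [evenBernoulliCoeff]
      have hu : (2 * (u + 1)).factorial = (2 * u + 2) * (2 * u + 1).factorial := rfl
      have hv : (2 * (v + 1)).factorial = (2 * v + 2) * (2 * v + 1).factorial := rfl
      have := Nat.factorial_ne_zero (2 * u + 1)
      have := Nat.factorial_ne_zero (2 * v + 1)
      have := Nat.factorial_ne_zero (2 * (s + 1))
      have := Nat.factorial_ne_zero (2 * (s + 1) + (2 * u + 1))
      have h1 : ((2 * (s + 1) + (2 * u + 1) + (2 * v + 1) : ℕ) : ℚ) + 1 -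
          (2 * (s + 1) + (2 * u + 1) : ℕ) = 2 * v + 2 := by
        push_cast; ring
      have h2 : ((2 * (s + 1) + (2 * u + 1) : ℕ) : ℚ) + 1 - (2 * (s + 1) : ℕ) = 2 * u + 2 := by
        push_cast; ring
      rw [hu, hv, h1, h2]
      push_cast
      field_simp

/-- Summing over `t - s` first, with `s` fixed, exposes Euler's recurrence at `p = R - s - 1`,
whence the weight `2p + 5`. -/
lemma termM₂_eq' (q R : ℕ) : termM₂ q (2 * (R + 1)) = -((2 * (R + 1)).factorial *
    ∑ s ∈ Finset.range R, (2 * (R - s : ℕ) + 3) * (evenBernoulliCoeff (s + 1) *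
      jordanTotient (2 * (s + 1)) q * evenBernoulliCoeff (R - s + 1))) := by
  rw [termM₂_eq, ← mul_neg, ← Finset.sum_neg_distrib]
  congr 1
  have h := Finset.sum_range_diag_flip R (fun s u ↦ evenBernoulliCoeff (s + 1) *
      jordanTotient (2 * (s + 1)) q * evenBernoulliCoeff (u + 1) *
        evenBernoulliCoeff (R - s - u))
  refine (Finset.sum_congr rfl fun t ht ↦ Finset.sum_congr rfl fun s hs ↦ ?_).trans
    (h.trans (Finset.sum_congr rfl fun s hs ↦ ?_))
  · rw [show R - s - (t - s) = R - t by have := Finset.mem_range.mp hs; lia]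
  obtain ⟨p, hp⟩ : ∃ p, R - s = p + 1 := ⟨R - s - 1, by have := Finset.mem_range.mp hs; lia⟩
  rw [hp]
  have := sum_evenBernoulliCoeff_mul p
  simp only [mul_assoc, ← Finset.mul_sum]
  rw [this]
  push_cast
  ring

lemma termM₃_eq (q R : ℕ) : termM₃ q (2 * (R + 1)) = (2 * (R + 1)).factorial *
    (evenBernoulliCoeff (R + 2) * jordanTotient (2 * (R + 2)) q -
      evenBernoulliCoeff (R + 1) * evenBernoulliCoeff 1 * jordanTotient (2 * 1) q) := by
  rw [termM₃, evenBernoulliCoeff_one, bernoulli_two]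
  simp only [evenBernoulliCoeff]
  have h : (2 * (R + 2)).factorial = (2 * (R + 1) + 2) * ((2 * (R + 1) + 1) *
    (2 * (R + 1)).factorial) := rfl
  rw [h, show 2 * (R + 1) + 2 = 2 * (R + 2) by ring]
  have := Nat.factorial_ne_zero (2 * (R + 1))
  push_cast
  field_simp
  ring

/-- For `s < R` the weights `2` of `M₁` and `-(2(R - s) + 3)` of `M₂` add to `-(2(R - s) + 1)`. At
`s = R` only `M₁` contributes, and `2/12 = -1/12 + 1/4` accounts for the last term. -/
lemma termM_sum_eq (q R : ℕ) : termM₁ q (2 * (R + 1)) + termM₂ q (2 * (R + 1)) +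
    termM₃ q (2 * (R + 1)) = (2 * (R + 1)).factorial *
    (evenBernoulliCoeff (R + 2) * jordanTotient (2 * (R + 2)) q -
      evenBernoulliCoeff (R + 1) * evenBernoulliCoeff 1 * jordanTotient (2 * 1) q -
      (∑ i ∈ Finset.range (R + 1), (2 * i + 1) * evenBernoulliCoeff (i + 1) *
        (evenBernoulliCoeff (R + 1 - i) * jordanTotient (2 * (R + 1 - i)) q)) +
      1 / 4 * (evenBernoulliCoeff (R + 1) * jordanTotient (2 * (R + 1)) q)) := by
  have hs : ∑ i ∈ Finset.range (R + 1), (2 * (i : ℚ) + 1) * evenBernoulliCoeff (i + 1) *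
        (evenBernoulliCoeff (R + 1 - i) * jordanTotient (2 * (R + 1 - i)) q) =
      ∑ s ∈ Finset.range (R + 1), (2 * (R - s : ℕ) + 1) * (evenBernoulliCoeff (s + 1) *
        jordanTotient (2 * (s + 1)) q * evenBernoulliCoeff (R - s + 1)) := by
    rw [← Finset.sum_range_reflect]
    refine Finset.sum_congr rfl fun s hs ↦ ?_
    rw [Finset.mem_range] at hs
    rw [Nat.add_sub_cancel, show R + 1 - (R - s) = s + 1 by lia]
    ring
  have hs' : ∑ s ∈ Finset.range R, (2 * (R - s : ℕ) + 1) * (evenBernoulliCoeff (s + 1) *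
        jordanTotient (2 * (s + 1)) q * evenBernoulliCoeff (R - s + 1)) =
      ∑ s ∈ Finset.range R, (2 * (R - s : ℕ) + 3) * (evenBernoulliCoeff (s + 1) *
        jordanTotient (2 * (s + 1)) q * evenBernoulliCoeff (R - s + 1)) -
      ∑ s ∈ Finset.range R, 2 * (evenBernoulliCoeff (s + 1) *
        jordanTotient (2 * (s + 1)) q * evenBernoulliCoeff (R - s + 1)) := by
    rw [← Finset.sum_sub_distrib]
    exact Finset.sum_congr rfl fun s _ ↦ by ring
  rw [termM₁_eq, termM₂_eq', termM₃_eq, hs, Finset.sum_range_succ _ R,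
    Finset.sum_range_succ _ R, hs', Nat.sub_self, zero_add, evenBernoulliCoeff_one]
  push_cast
  ring

end Terms

/-! ### Assembly of the formula. -/

section Main

theorem meanV_one_one_even_eq (q : ℕ) [NeZero q] (hq : 2 ≤ q) {n : ℕ} (hn : 0 < n)
    (hn2 : Even n) : meanV q 1 1 n 1 1 1 =
      (-1) ^ (n / 2) * (2 * (Real.pi : ℂ)) ^ (n + 2) * (q.totient : ℂ) ^ 2 /
          (8 * (q : ℂ) ^ (n + 2) * (n.factorial : ℂ)) *
        ((termM₁ q n + termM₂ q n + termM₃ q n : ℚ) : ℂ) := by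
  obtain ⟨R, rfl⟩ : ∃ R, n = 2 * (R + 1) := by
    obtain ⟨r, hr⟩ := hn2
    exact ⟨r - 1, by lia⟩
  -- The signs and powers of `2π` from the two zeta values combine to a factor independent of `i`.
  have hsum : ∑ i ∈ Finset.range (R + 1), (2 * (i : ℂ) + 1) *
        (2 * riemannZeta (2 * (i + 1) : ℕ)) *
        (riemannZeta (2 * (R + 1 - i) : ℕ) * jordanTotient (2 * (R + 1 - i)) q) =
      (-1) ^ R * (2 * (Real.pi : ℂ)) ^ (2 * (R + 2)) / 2 *
      ∑ i ∈ Finset.range (R + 1), (2 * (i : ℂ) + 1) * evenBernoulliCoeff (i + 1) *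
        (evenBernoulliCoeff (R + 1 - i) * jordanTotient (2 * (R + 1 - i)) q) := by
    rw [Finset.mul_sum]
    refine Finset.sum_congr rfl fun i hi ↦ ?_
    obtain ⟨t, rfl⟩ : ∃ t, R = i + t := ⟨R - i, by have := Finset.mem_range.mp hi; lia⟩
    rw [show i + t + 1 - i = t + 1 by lia, riemannZeta_eq_evenBernoulliCoeff (by lia),
      riemannZeta_eq_evenBernoulliCoeff (by lia)]
    ring
  have hq0 : (q : ℂ) ≠ 0 := NeZero.ne _
  have hf : ((2 * (R + 1)).factorial : ℂ) ≠ 0 := by exact_mod_cast Nat.factorial_ne_zero _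
  rw [meanV_one_one_even hq (by lia), hsum, riemannZeta_eq_evenBernoulliCoeff (by lia),
    riemannZeta_eq_evenBernoulliCoeff (by lia), riemannZeta_eq_evenBernoulliCoeff (by lia),
    termM_sum_eq, Nat.mul_div_cancel_left _ two_pos]
  push_cast
  field_simp
  ring

lemma termM₂_two (q : ℕ) : termM₂ q 2 = 0 := by simp [termM₂]

end Main

theorem corollary2p5 (q : ℕ) [NeZero q] (hq : 2 ≤ q) :
    (∀ n : ℕ, 0 < n → Even n →
      meanV q 1 1 n 1 1 1 =
        (-1) ^ (n / 2) * (2 * (Real.pi : ℂ)) ^ (n + 2) * (q.totient : ℂ) ^ 2 /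
            (8 * (q : ℂ) ^ (n + 2) * (n.factorial : ℂ)) *
          ((termM₁ q n + termM₂ q n + termM₃ q n : ℚ) : ℂ)) ∧
    termM₂ q 2 = 0 ∧
    meanV q 1 1 2 1 1 1 =
      (Real.pi : ℂ) ^ 4 * (q.totient : ℂ) ^ 2 / (360 * (q : ℂ) ^ 4) *
        ((jordanTotient 4 q - 5 * jordanTotient 2 q : ℚ) : ℂ) ∧
    meanV q 1 1 4 1 1 1 =
      (Real.pi : ℂ) ^ 6 * (q.totient : ℂ) ^ 2 / (3780 * (q : ℂ) ^ 6) *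
        ((jordanTotient 6 q - 7 * jordanTotient 4 q + 14 * jordanTotient 2 q : ℚ) : ℂ) := by
  have hq0 : (q : ℂ) ≠ 0 := NeZero.ne _
  have b4 : bernoulli 4 = -1 / 30 := by
    rw [bernoulli_eq_bernoulli'_of_ne_one (by decide), bernoulli'_four]
  -- Euler's recurrence at `p = 1` determines `B₆` from `B₂` and `B₄`.
  have b6 : bernoulli 6 = 1 / 42 := by
    have := sum_evenBernoulliCoeff_mul 1
    simp only [evenBernoulliCoeff, Finset.sum_range_succ, Finset.sum_range_zero] at this
    norm_num [bernoulli_two, b4, Nat.factorial] at this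
    linarith
  have e2 : evenBernoulliCoeff 2 = -1 / 720 := by norm_num [evenBernoulliCoeff, b4, Nat.factorial]
  have e3 : evenBernoulliCoeff 3 = 1 / 30240 := by norm_num [evenBernoulliCoeff, b6, Nat.factorial]
  refine ⟨fun n hn hn2 ↦ meanV_one_one_even_eq q hq hn hn2, termM₂_two q, ?_, ?_⟩
  · rw [meanV_one_one_even_eq q hq two_pos even_two,
      show termM₁ q 2 + termM₂ q 2 + termM₃ q 2 = _ from termM_sum_eq q 0]
    simp [evenBernoulliCoeff_one, e2, Nat.factorial]
    field_simp
    ring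
  · rw [meanV_one_one_even_eq q hq (by decide) (by decide),
      show termM₁ q 4 + termM₂ q 4 + termM₃ q 4 = _ from termM_sum_eq q 1]
    simp [Finset.sum_range_succ, evenBernoulliCoeff_one, e2, e3, Nat.factorial]
    field_simp
    ring
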